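/- Consider a quantum spin system on the $D$-dimensional periodic square lattice $\Lambda=(\mathbb{Z}/L\mathbb{Z})^D$ with its graph distance $d(\cdot,\cdot)$ and with local Hilbert space $\mathbb{C}^d$ ($d\ge 1$) at each site; $\|\cdot\|$ is the operator norm on operators on $\bigotimes_{x\in\Lambda}\mathbb{C}^d$. For a Hermitian operator $H$ put $O(t)=e^{-iHt}Oe^{iHt}$. We say that $H$ satisfies the Lieb--Robinson bound with constants $c,c_1>0$ and velocity $v>0$ if $$\|[O_A(t),O_B]\|\le c\,\|O_A\|\,\|O_B\|\,\min(|A|,|B|)\,e^{c_1(v|t|-d(A,B))}$$ for all $A,B\subseteq\Lambda$, all observables (Hermitian operators) $O_A$, $O_B$ supported on $A$, $B$ respectively, and all $t\in\mathbb{R}$. For $\beta>0$ let $f_1^\beta\in L^1(\mathbb{R})$ be the function with $$\int_{-\infty}^{\infty} e^{-i\omega t}f_1^\beta(t)\,dt=\frac{\tanh(\beta\omega/2)}{\beta\omega/2}\qquad(\omega\in\mathbb{R}),$$ the right-hand side being read as $1$ at $\omega=0$, and let $\Phi_{f_1^\beta}(O)=\int_{-\infty}^{\infty}e^{-iHt}Oe^{iHt}f_1^\beta(t)\,dt$.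 For $A\subseteq\Lambda$ let $[O]_A=\frac{1}{\dim A^c}\mathrm{Tr}_{A^c}(O)\otimes I_{A^c}$, where $\dim A^c$ is the dimension of the Hilbert space of the sites outside $A$. **Corollary.** For every $\beta>0$ such a function $f_1^\beta$ exists. Moreover, for all $D$, $r_0$ and all $c,c_1>0$ there are constants $0<C,c'<\infty$, depending only on $D,r_0,c,c_1$, such that the following holds for all $L,d\ge1$, every Hermitian $H$ satisfying the Lieb--Robinson bound with constants $c,c_1$ and some velocity $v>0$, every $\beta>0$, every operator $v_i$ whose support is contained in a ball of radius $r_0$, and every $r\ge0$: $$\bigl\|\Phi_{f_1^\beta}(v_i)-[\Phi_{f_1^\beta}(v_i)]_{v_i(r)}\bigr\|\le C\,\|v_i\|\,\exp\Bigl(-\frac{c'r}{1+c'v\beta/\pi}\Bigr),$$ where $v_i(r)$ is the set of sites at distance at most $r$ from the support of $v_i$. -/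

import Mathlib

open MeasureTheory
open scoped BigOperators Matrix.Norms.L2Operator

noncomputable section

namespace SpinLattice

/-- Sites of the `D`-dimensional square (hypercubic) lattice of linear size `L` with periodic
boundary conditions. -/
abbrev Site (D L : ℕ) : Type := Fin D → ZMod L

/-- Product basis labels of the Hilbert space with local dimension `d` at every site. -/
abbrev Config (D L d : ℕ) : Type := Site D L → Fin d

/-- Operators on the Hilbert space `⨂ₓ ℂᵈ`, as matrices in the product basis; their norm is the
operator norm on the `ℓ²` space. -/
abbrev Op (D L d : ℕ) : Type := Matrix (Config D L d) (Config D L d) ℂ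

/-- Graph distance on the periodic lattice. -/
def siteDist {D L : ℕ} (x y : Site D L) : ℕ :=
  ∑ k, (x k - y k).valMinAbs.natAbs

/-- Distance between two regions, `min_{x ∈ A, y ∈ B} d(x, y)`. (It is only used multiplied by
`min |A| |B|`, so its value for an empty region plays no role.) -/
def regionDist {D L : ℕ} (A B : Finset (Site D L)) : ℕ :=
  sInf {n : ℕ | ∃ x ∈ A, ∃ y ∈ B, n = siteDist x y}

section

variable {D L d : ℕ} [NeZero L]

/-- The ball `{y | d(x, y) ≤ r}`. -/
def siteBall (x : Site D L) (r : ℝ) : Finset (Site D L) := by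
  classical exact Finset.univ.filter fun y => (siteDist x y : ℝ) ≤ r

/-- The set `A(r)` of all sites at distance at most `r` from the region `A`. -/
def nbhd (A : Finset (Site D L)) (r : ℝ) : Finset (Site D L) := by
  classical exact Finset.univ.filter fun y => ∃ x ∈ A, (siteDist x y : ℝ) ≤ r

/-- The configuration equal to `a` on `A` and to `η` on the complement of `A`. -/
def glue (A : Finset (Site D L)) (a : A → Fin d) (η : {x : Site D L // x ∉ A} → Fin d) :
    Config D L d :=
  fun x => if h : x ∈ A then a ⟨x, h⟩ else η ⟨x, h⟩

/-- `M ⊗ I_{Aᶜ}` for an operator `M` on the Hilbert space of the region `A`. -/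
def tensorId (A : Finset (Site D L)) (M : Matrix (A → Fin d) (A → Fin d) ℂ) : Op D L d :=
  Matrix.of fun σ τ =>
    if (fun x : {x : Site D L // x ∉ A} => σ x) = (fun x : {x : Site D L // x ∉ A} => τ x) then
      M (fun x => σ x) (fun x => τ x)
    else 0

/-- The partial trace `Tr_{Aᶜ} O`, an operator on the Hilbert space of the region `A`. -/
def partialTrace (A : Finset (Site D L)) (O : Op D L d) : Matrix (A → Fin d) (A → Fin d) ℂ :=
  Matrix.of fun a b => ∑ η : {x : Site D L // x ∉ A} → Fin d, O (glue A a η) (glue A b η)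

/-- The localization `[O]_A = (dim Aᶜ)⁻¹ • Tr_{Aᶜ}(O) ⊗ I_{Aᶜ}`. -/
def localize (A : Finset (Site D L)) (O : Op D L d) : Op D L d :=
  (Fintype.card ({x : Site D L // x ∉ A} → Fin d) : ℂ)⁻¹ • tensorId A (partialTrace A O)

/-- `O` acts trivially outside `A`, i.e. `O = M ⊗ I_{Aᶜ}`. -/
def SupportedOn (A : Finset (Site D L)) (O : Op D L d) : Prop :=
  ∃ M : Matrix (A → Fin d) (A → Fin d) ℂ, O = tensorId A M

/-- The support of `O`: the intersection of all regions outside of which `O` acts trivially. -/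
def opSupport (O : Op D L d) : Finset (Site D L) := by
  classical exact Finset.univ.filter fun x => ∀ A : Finset (Site D L), SupportedOn A O → x ∈ A

/-- Time evolution `O(t) = e^{-iHt} O e^{iHt}`. -/
def evolve (H : Op D L d) (t : ℝ) (O : Op D L d) : Op D L d :=
  NormedSpace.exp ((-(Complex.I * t)) • H) * O * NormedSpace.exp ((Complex.I * t) • H)

/-- `H` satisfies the Lieb-Robinson bound with constants `c`, `c₁` and velocity `v`:
`‖[P(t), Q]‖ ≤ c ‖P‖ ‖Q‖ min(|A|, |B|) exp(c₁ (v |t| - d(A, B)))` for all observables `P`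
supported on `A` and `Q` supported on `B`. -/
def LiebRobinson (H : Op D L d) (c c₁ v : ℝ) : Prop :=
  ∀ (A B : Finset (Site D L)) (P Q : Op D L d), P.IsHermitian → Q.IsHermitian →
    SupportedOn A P → SupportedOn B Q → ∀ t : ℝ,
      ‖evolve H t P * Q - Q * evolve H t P‖ ≤
        c * ‖P‖ * ‖Q‖ * (min A.card B.card : ℕ) *
          Real.exp (c₁ * (v * |t| - regionDist A B))

/-- The superoperator `Φ_f(O) = ∫ e^{-iHt} O e^{iHt} f(t) dt`. -/
def Phi (H : Op D L d) (f : ℝ → ℂ) (O : Op D L d) : Op D L d :=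
  ∫ t : ℝ, f t • evolve H t O

end

/-- The function `ω ↦ tanh(βω/2) / (βω/2)`, with its continuous value `1` at `ω = 0`. -/
def tanhSymbol (β ω : ℝ) : ℝ :=
  if ω = 0 then 1 else Real.tanh (β * ω / 2) / (β * ω / 2)

/-- `f` is (a representative of) the integrable function `f₁^β` with
`∫ e^{-iωt} f(t) dt = tanh(βω/2) / (βω/2)` for all `ω`; this determines `f` almost everywhere,
hence determines `Phi H f`. -/
def IsThermalFilter (β : ℝ) (f : ℝ → ℂ) : Prop :=
  Integrable f ∧
    ∀ ω : ℝ, ∫ t : ℝ, Complex.exp (-(Complex.I * ω * t)) * f t = (tanhSymbol β ω : ℂ)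

end SpinLattice

end

namespace SpinLattice

section Filter

theorem HasSum.of_eq {E : Type*} [AddCommMonoid E] [TopologicalSpace E] {f g : ℕ → E} {a b : E}
    (h : HasSum g b) (hf : ∀ k, f k = g k) (ha : a = b) : HasSum f a := by
  rwa [funext hf, ha]

open Complex in
theorem hasSum_pi_mul_tan {z : ℂ} (hz : z ∈ Complex.integerComplement)
    (hz2 : z / 2 ∈ Complex.integerComplement) :
    HasSum (fun k : ℕ => 4 * z / ((2 * k + 1) ^ 2 - z ^ 2))
      (Real.pi * Complex.tan (Real.pi * z / 2)) := by
  have key : ∀ x : ℂ, x ∈ Complex.integerComplement →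
      HasSum (fun n : ℕ => 1 / (x - (n + 1)) + 1 / (x + (n + 1)))
        (Real.pi * cot (Real.pi * x) - 1 / x) := by
    intro x hx
    have hs := summable_cotTerm hx
    rw [cot_series_rep' hx]
    exact hs.hasSum
  have h1 := key z hz
  have h2 := (key (z / 2) hz2).mul_left (1 / 2)
  have hne : ∀ x : ℂ, x ∈ Complex.integerComplement → ∀ n : ℤ, x - n ≠ 0 := by
    intro x hx n h
    exact hx ⟨n, (sub_eq_zero.mp h).symm⟩
  have hsum := h1.summable
  have hev : Summable fun k : ℕ => 1 / (z - ((2 * k : ℕ) + 1)) + 1 / (z + ((2 * k : ℕ) + 1)) :=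
    hsum.comp_injective (i := fun k : ℕ => 2 * k) (fun a b h => by simpa using h)
  have hodd : HasSum (fun k : ℕ => 1 / (z - ((2 * k + 1 : ℕ) + 1)) + 1 / (z + ((2 * k + 1 : ℕ) + 1)))
      (1 / 2 * (Real.pi * cot (Real.pi * (z / 2)) - 1 / (z / 2))) := by
    refine HasSum.of_eq h2 (fun k => ?_) rfl
    have e1 : z - ((2 * k + 1 : ℕ) + 1) = 2 * (z / 2 - (k + 1)) := by push_cast; ring
    have e2 : z + ((2 * k + 1 : ℕ) + 1) = 2 * (z / 2 + (k + 1)) := by push_cast; ring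
    rw [e1, e2]
    simp only [one_div, mul_inv]
    ring
  have huniq := (HasSum.even_add_odd
    (f := fun n : ℕ => 1 / (z - (n + 1)) + 1 / (z + (n + 1))) hev.hasSum hodd).unique h1
  have hval : ∑' k : ℕ, (1 / (z - ((2 * k : ℕ) + 1)) + 1 / (z + ((2 * k : ℕ) + 1))) =
      -(1 / 2) * (Real.pi * Complex.tan (Real.pi * z / 2)) := by
    rw [← eq_sub_iff_add_eq] at huniq
    rw [huniq]
    have hz0 : z ≠ 0 := by simpa using hne z hz 0
    have hs : Complex.sin (Real.pi * z / 2) ≠ 0 := by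
      intro h
      obtain ⟨n, hn⟩ := Complex.sin_eq_zero_iff.mp h
      refine hne _ hz2 n ?_
      have : (Real.pi : ℂ) ≠ 0 := by exact_mod_cast Real.pi_ne_zero
      have h3 : (Real.pi : ℂ) * (z / 2 - n) = 0 := by linear_combination hn
      exact (mul_eq_zero.mp h3).resolve_left this
    have hc : Complex.cos (Real.pi * z / 2) ≠ 0 := by
      intro h
      obtain ⟨n, hn⟩ := Complex.cos_eq_zero_iff.mp h
      refine hne _ hz (2 * n + 1) ?_
      have : (Real.pi : ℂ) ≠ 0 := by exact_mod_cast Real.pi_ne_zero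
      have h3 : (Real.pi : ℂ) * (z - (2 * n + 1 : ℤ)) = 0 := by
        push_cast; linear_combination 2 * hn
      exact (mul_eq_zero.mp h3).resolve_left this
    have e : (Real.pi : ℂ) * z = 2 * (Real.pi * z / 2) := by ring
    have e' : (Real.pi : ℂ) * (z / 2) = Real.pi * z / 2 := by ring
    rw [e', e, Complex.cot, Complex.cot, Complex.tan, Complex.sin_two_mul, Complex.cos_two_mul']
    have hsc := Complex.sin_sq_add_cos_sq (Real.pi * z / 2)
    rw [← e]
    set s := Complex.sin (Real.pi * z / 2)
    set c := Complex.cos (Real.pi * z / 2)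
    field_simp
    ring
  have h3 := hev.hasSum
  rw [hval] at h3
  refine HasSum.of_eq (h3.mul_left (-2)) (fun k => ?_) ?_
  · have a1 : z - ((2 * k : ℕ) + 1) ≠ 0 := by simpa using hne z hz (2 * k + 1)
    have a2 : z + ((2 * k : ℕ) + 1) ≠ 0 := by
      have := hne z hz (-(2 * k + 1))
      intro h; apply this; push_cast at h ⊢; linear_combination h
    have a3 : ((2 * k + 1) ^ 2 - z ^ 2 : ℂ) ≠ 0 := by
      have : ((2 * k + 1) ^ 2 - z ^ 2 : ℂ) = -((z - ((2 * k : ℕ) + 1)) * (z + ((2 * k : ℕ) + 1))) := by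
        push_cast; ring
      rw [this]; exact neg_ne_zero.mpr (mul_ne_zero a1 a2)
    field_simp
    push_cast
    ring
  · ring

theorem summable_one_div_odd_sq : Summable fun k : ℕ => 1 / (2 * (k : ℝ) + 1) ^ 2 := by
  have := (Real.summable_one_div_nat_pow.mpr (one_lt_two)).comp_injective
    (i := fun k : ℕ => 2 * k + 1) (fun a b h => by simpa using h)
  simpa [Function.comp_def] using this

theorem hasSum_one_div_odd_sq :
    HasSum (fun k : ℕ => 1 / (2 * (k : ℝ) + 1) ^ 2) (Real.pi ^ 2 / 8) := by
  have hz := hasSum_zeta_two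
  have hev : HasSum (fun k : ℕ => 1 / (((2 * k : ℕ) : ℝ)) ^ 2) (1 / 4 * (Real.pi ^ 2 / 6)) := by
    refine HasSum.of_eq (hz.mul_left (1 / 4)) (fun k => ?_) rfl
    push_cast
    rw [mul_pow, one_div_mul_one_div]
    norm_num
  have hodd : HasSum (fun k : ℕ => 1 / (((2 * k + 1 : ℕ) : ℝ)) ^ 2)
      (∑' k : ℕ, 1 / (2 * (k : ℝ) + 1) ^ 2) := by
    refine HasSum.of_eq summable_one_div_odd_sq.hasSum (fun k => ?_) rfl
    push_cast; rfl
  have h := (HasSum.even_add_odd (f := fun n : ℕ => 1 / (n : ℝ) ^ 2) hev hodd).unique hz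
  have : ∑' k : ℕ, 1 / (2 * (k : ℝ) + 1) ^ 2 = Real.pi ^ 2 / 8 := by linarith
  rw [← this]
  exact summable_one_div_odd_sq.hasSum

theorem hasSum_tanhSymbol {β : ℝ} (hβ : 0 < β) (ω : ℝ) :
    HasSum (fun k : ℕ => 8 / ((2 * (k : ℝ) + 1) ^ 2 * Real.pi ^ 2 + β ^ 2 * ω ^ 2))
      (tanhSymbol β ω) := by
  have hpi := Real.pi_pos
  by_cases hω : ω = 0
  · subst hω
    refine HasSum.of_eq (hasSum_one_div_odd_sq.mul_left (8 / Real.pi ^ 2)) (fun k => ?_) ?_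
    · have : (2 * (k : ℝ) + 1) ≠ 0 := by positivity
      field_simp
      simp
    · simp only [tanhSymbol, if_true]
      field_simp
  · set y : ℝ := β * ω / Real.pi with hy
    have hy0 : y ≠ 0 := by positivity
    have hmem : ∀ u : ℝ, u ≠ 0 → (u : ℂ) * Complex.I ∈ Complex.integerComplement := by
      rintro u hu ⟨n, hn⟩
      apply hu
      have := congrArg Complex.im hn
      simpa using this.symm
    have h := hasSum_pi_mul_tan (hmem y hy0)
      (by simpa [div_mul_eq_mul_div] using hmem (y / 2) (by positivity))
    have e1 : (Real.pi : ℂ) * (y * Complex.I) / 2 = ((β * ω / 2 : ℝ) : ℂ) * Complex.I := by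
      rw [hy]; push_cast
      have : (Real.pi : ℂ) ≠ 0 := by exact_mod_cast hpi.ne'
      field_simp
    rw [e1, Complex.tan_mul_I] at h
    have h2 := h.mul_left (2 / (Real.pi ^ 2 * y * Complex.I))
    rw [← Complex.hasSum_ofReal]
    have hyc : (y : ℂ) ≠ 0 := by exact_mod_cast hy0
    have hpc : (Real.pi : ℂ) ≠ 0 := by exact_mod_cast hpi.ne'
    refine HasSum.of_eq h2 (fun k => ?_) ?_
    · have hp : ((2 * (k : ℝ) + 1) ^ 2 * Real.pi ^ 2 + β ^ 2 * ω ^ 2) ≠ 0 := by positivity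
      have hq : ((2 * (k : ℝ) + 1) ^ 2 + y ^ 2) ≠ 0 := by positivity
      have e : 8 / ((2 * (k : ℝ) + 1) ^ 2 * Real.pi ^ 2 + β ^ 2 * ω ^ 2) =
          8 / (Real.pi ^ 2 * ((2 * (k : ℝ) + 1) ^ 2 + y ^ 2)) := by
        rw [hy]; congr 1; field_simp
      have hqc : ((2 * (k : ℂ) + 1) ^ 2 + (y : ℂ) ^ 2) ≠ 0 := by exact_mod_cast hq
      have e2 : (2 * (k : ℂ) + 1) ^ 2 - ((y : ℂ) * Complex.I) ^ 2 =
          (2 * (k : ℂ) + 1) ^ 2 + (y : ℂ) ^ 2 := by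
        rw [mul_pow, Complex.I_sq]; ring
      rw [e, e2]; push_cast
      field_simp
      norm_num
    · rw [tanhSymbol, if_neg hω]
      have e3 : β * ω / 2 = Real.pi * y / 2 := by rw [hy]; field_simp
      rw [e3]; push_cast
      field_simp

theorem integrable_exp_neg_mul_abs {a : ℝ} (ha : 0 < a) :
    Integrable fun t : ℝ => Real.exp (-(a * |t|)) := by
  rw [← integrableOn_univ, ← Set.Iic_union_Ioi (a := (0 : ℝ)), integrableOn_union]
  constructor
  · refine (integrableOn_exp_mul_Iic ha 0).congr_fun (fun t ht => ?_) measurableSet_Iic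
    simp only [abs_of_nonpos (Set.mem_Iic.mp ht)]; congr 1; ring
  · refine (integrableOn_exp_mul_Ioi (neg_lt_zero.mpr ha) 0).congr_fun (fun t ht => ?_)
      measurableSet_Ioi
    simp only [abs_of_pos (Set.mem_Ioi.mp ht)]; congr 1; ring

theorem integral_exp_neg_mul_abs {a : ℝ} (ha : 0 < a) :
    ∫ t : ℝ, Real.exp (-(a * |t|)) = 2 / a := by
  rw [integral_comp_abs (f := fun t => Real.exp (-(a * t)))]
  have := integral_exp_mul_Ioi (neg_lt_zero.mpr ha) 0
  simp only [neg_mul, mul_zero, Real.exp_zero] at this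
  rw [this]
  field_simp

theorem integral_cexp_mul_exp_neg_mul_abs {a : ℝ} (ha : 0 < a) (ω : ℝ) :
    ∫ t : ℝ, Complex.exp (-(Complex.I * ω * t)) * (Real.exp (-(a * |t|)) : ℝ) =
      ((2 * a / (a ^ 2 + ω ^ 2) : ℝ) : ℂ) := by
  have hint : Integrable fun t : ℝ =>
      Complex.exp (-(Complex.I * ω * t)) * ((Real.exp (-(a * |t|)) : ℝ) : ℂ) := by
    refine (integrable_exp_neg_mul_abs ha).ofReal.bdd_mul (c := 1) ?_ ?_
    · exact Continuous.aestronglyMeasurable (by fun_prop)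
    · refine Filter.Eventually.of_forall fun t => ?_
      rw [Complex.norm_exp]; simp
  rw [← intervalIntegral.integral_Iic_add_Ioi (b := 0) hint.integrableOn hint.integrableOn]
  have h1 : ∫ t in Set.Iic (0 : ℝ),
      Complex.exp (-(Complex.I * ω * t)) * ((Real.exp (-(a * |t|)) : ℝ) : ℂ) =
      ∫ t in Set.Iic (0 : ℝ), Complex.exp ((a - Complex.I * ω) * t) := by
    refine setIntegral_congr_fun measurableSet_Iic fun t ht => ?_
    simp only [abs_of_nonpos (Set.mem_Iic.mp ht)]
    push_cast; rw [← Complex.exp_add]; congr 1; ring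
  have h2 : ∫ t in Set.Ioi (0 : ℝ),
      Complex.exp (-(Complex.I * ω * t)) * ((Real.exp (-(a * |t|)) : ℝ) : ℂ) =
      ∫ t in Set.Ioi (0 : ℝ), Complex.exp ((-a - Complex.I * ω) * t) := by
    refine setIntegral_congr_fun measurableSet_Ioi fun t ht => ?_
    simp only [abs_of_pos (Set.mem_Ioi.mp ht)]
    push_cast; rw [← Complex.exp_add]; congr 1; ring
  rw [h1, h2, integral_exp_mul_complex_Iic (by simpa using ha),
    integral_exp_mul_complex_Ioi (by simpa using ha)]
  have n1 : (a - Complex.I * ω : ℂ) ≠ 0 := fun h => ha.ne' (by simpa using congrArg Complex.re h)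
  have n2 : (-a - Complex.I * ω : ℂ) ≠ 0 := fun h => ha.ne' (by simpa using congrArg Complex.re h)
  have n3 : ((a : ℂ) ^ 2 + (ω : ℂ) ^ 2) ≠ 0 := by
    have : a ^ 2 + ω ^ 2 ≠ 0 := by positivity
    exact_mod_cast this
  have e : (a - Complex.I * ω : ℂ) * (-a - Complex.I * ω) = -((a : ℂ) ^ 2 + (ω : ℂ) ^ 2) := by
    linear_combination (ω : ℂ) ^ 2 * Complex.I_sq
  push_cast
  simp only [mul_zero, Complex.exp_zero]
  rw [div_add_div _ _ n1 n2, e, div_eq_div_iff (neg_ne_zero.mpr n3) n3]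
  ring

/-- The `k`-th term of the exponential series of the thermal filter. -/
noncomputable def filterTerm (β : ℝ) (k : ℕ) (t : ℝ) : ℝ :=
  4 / (β * Real.pi * (2 * k + 1)) * Real.exp (-((2 * k + 1) * Real.pi / β * |t|))

/-- The thermal filter `f₁^β`, as a series of exponentials. -/
noncomputable def thermalFilter (β : ℝ) (t : ℝ) : ℝ := ∑' k, filterTerm β k t

variable {β : ℝ}

theorem filterTerm_nonneg (hβ : 0 < β) (k : ℕ) (t : ℝ) : 0 ≤ filterTerm β k t := by
  have := Real.pi_pos
  unfold filterTerm; positivity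

theorem thermalFilter_nonneg (hβ : 0 < β) (t : ℝ) : 0 ≤ thermalFilter β t :=
  tsum_nonneg fun k => filterTerm_nonneg hβ k t

theorem integrable_filterTerm (hβ : 0 < β) (k : ℕ) : Integrable (filterTerm β k) :=
  (integrable_exp_neg_mul_abs (by have := Real.pi_pos; positivity)).const_mul _

theorem integral_filterTerm (hβ : 0 < β) (k : ℕ) :
    ∫ t, filterTerm β k t = 8 / Real.pi ^ 2 * (1 / (2 * (k : ℝ) + 1) ^ 2) := by
  have := Real.pi_pos
  unfold filterTerm
  rw [integral_const_mul, integral_exp_neg_mul_abs (by positivity)]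
  field_simp
  norm_num

theorem integral_cexp_mul_thermalFilter (hβ : 0 < β) (ω : ℝ) :
    ∫ t : ℝ, Complex.exp (-(Complex.I * ω * t)) * (thermalFilter β t : ℂ) =
      (tanhSymbol β ω : ℂ) := by
  have hpi := Real.pi_pos
  have hn : ∀ t : ℝ, ‖Complex.exp (-(Complex.I * ω * t))‖ = 1 := fun t => by
    rw [Complex.norm_exp]; simp
  have hint : ∀ k, Integrable fun t : ℝ =>
      Complex.exp (-(Complex.I * ω * t)) * (filterTerm β k t : ℂ) := fun k => by
    refine (integrable_filterTerm hβ k).ofReal.bdd_mul (c := 1) ?_ ?_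
    · exact Continuous.aestronglyMeasurable (by fun_prop)
    · exact Filter.Eventually.of_forall fun t => (hn t).le
  have hs : Summable fun k => ∫ t : ℝ,
      ‖Complex.exp (-(Complex.I * ω * t)) * (filterTerm β k t : ℂ)‖ := by
    refine (summable_one_div_odd_sq.mul_left (8 / Real.pi ^ 2)).congr fun k => ?_
    rw [← integral_filterTerm hβ]
    refine integral_congr_ae (Filter.Eventually.of_forall fun t => ?_)
    simp only [norm_mul, hn, one_mul, Complex.norm_real, Real.norm_eq_abs,
      abs_of_nonneg (filterTerm_nonneg hβ k t)]
  have h := hasSum_integral_of_summable_integral_norm hint hs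
  have e : ∀ t : ℝ, ∑' k, Complex.exp (-(Complex.I * ω * t)) * (filterTerm β k t : ℂ) =
      Complex.exp (-(Complex.I * ω * t)) * (thermalFilter β t : ℂ) := fun t => by
    rw [tsum_mul_left, thermalFilter, Complex.ofReal_tsum]
  simp only [e] at h
  refine h.unique ?_
  refine HasSum.of_eq (Complex.hasSum_ofReal.mpr (hasSum_tanhSymbol hβ ω)) (fun k => ?_) rfl
  have e2 : ∀ t : ℝ, Complex.exp (-(Complex.I * ω * t)) * (filterTerm β k t : ℂ) =
      ((4 / (β * Real.pi * (2 * k + 1)) : ℝ) : ℂ) * (Complex.exp (-(Complex.I * ω * t)) *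
        ((Real.exp (-((2 * k + 1) * Real.pi / β * |t|)) : ℝ) : ℂ)) := fun t => by
    unfold filterTerm; push_cast; ring
  simp only [e2]
  rw [integral_const_mul, integral_cexp_mul_exp_neg_mul_abs (by positivity), ← Complex.ofReal_mul]
  congr 1
  have hp : ((2 * (k : ℝ) + 1) ^ 2 * Real.pi ^ 2 + β ^ 2 * ω ^ 2) ≠ 0 := by positivity
  have hp2 : ((2 * (k : ℝ) + 1) * Real.pi / β) ^ 2 + ω ^ 2 ≠ 0 := by positivity
  field_simp
  ring

theorem integrable_thermalFilter (hβ : 0 < β) : Integrable (thermalFilter β) := by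
  by_contra h
  have h0 := integral_cexp_mul_thermalFilter hβ 0
  simp only [Complex.ofReal_zero, mul_zero, zero_mul, neg_zero, Complex.exp_zero, one_mul,
    integral_complex_ofReal, integral_undef h] at h0
  simp [tanhSymbol] at h0

theorem isThermalFilter_thermalFilter (hβ : 0 < β) :
    IsThermalFilter β fun t => (thermalFilter β t : ℂ) :=
  ⟨(integrable_thermalFilter hβ).ofReal, integral_cexp_mul_thermalFilter hβ⟩

end Filter

end SpinLattice

namespace SpinLattice

section Filter

open scoped FourierTransform ContDiff in
theorem ae_eq_zero_of_integral_cexp_eq_zero {h : ℝ → ℂ} (hi : Integrable h)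
    (h0 : ∀ w : ℝ, ∫ t : ℝ, Complex.exp (-(Complex.I * w * t)) * h t = 0) :
    ∀ᵐ t, h t = 0 := by
  have hF : 𝓕 h = 0 := by
    funext w
    rw [Real.fourier_eq']
    rw [Pi.zero_apply, ← h0 (2 * Real.pi * w)]
    congr 1
    funext t
    rw [smul_eq_mul]
    congr 2
    simp only [RCLike.inner_apply, conj_trivial]
    push_cast
    ring
  refine ae_eq_zero_of_integral_contDiff_smul_eq_zero hi.locallyIntegrable fun g hg hgc => ?_
  have hg₁ : HasCompactSupport (Complex.ofRealCLM ∘ g) := hgc.comp_left rfl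
  have hg₂ : ContDiff ℝ ∞ (Complex.ofRealCLM ∘ g) := by fun_prop
  let S : SchwartzMap ℝ ℂ := hg₁.toSchwartzMap hg₂
  have hS : ∀ t, S t = (g t : ℂ) := fun t => rfl
  have hSf : 𝓕 ((𝓕⁻ S : SchwartzMap ℝ ℂ) : ℝ → ℂ) = S := by
    rw [← SchwartzMap.fourier_coe, FourierTransform.fourier_fourierInv_eq]
  have key := VectorFourier.integral_fourierIntegral_smul_eq_flip (L := innerₗ ℝ) (μ := volume)
    (ν := volume) (f := h) (g := ((𝓕⁻ S : SchwartzMap ℝ ℂ) : ℝ → ℂ))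
    Real.continuous_fourierChar continuous_inner hi (SchwartzMap.integrable _)
  have e1 : VectorFourier.fourierIntegral Real.fourierChar volume (innerₗ ℝ) h = 𝓕 h := rfl
  have e2 : VectorFourier.fourierIntegral Real.fourierChar volume (innerₗ ℝ).flip
      ((𝓕⁻ S : SchwartzMap ℝ ℂ) : ℝ → ℂ) = S := by
    rw [flip_innerₗ, ← hSf]; rfl
  rw [e1, e2, hF] at key
  simp only [Pi.zero_apply, zero_smul, integral_zero] at key
  rw [key]
  refine integral_congr_ae (Filter.Eventually.of_forall fun t => ?_)
  simp only [hS, smul_eq_mul, Complex.real_smul, mul_comm]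

theorem IsThermalFilter.ae_eq {β : ℝ} {f g : ℝ → ℂ} (hf : IsThermalFilter β f)
    (hg : IsThermalFilter β g) : f =ᵐ[volume] g := by
  have hb : ∀ {u : ℝ → ℂ} (ω : ℝ), Integrable u →
      Integrable fun t : ℝ => Complex.exp (-(Complex.I * ω * t)) * u t := fun ω hu => by
    refine hu.bdd_mul (c := 1) (Continuous.aestronglyMeasurable (by fun_prop)) ?_
    exact Filter.Eventually.of_forall fun t => by rw [Complex.norm_exp]; simp
  have := ae_eq_zero_of_integral_cexp_eq_zero (hf.1.sub hg.1) fun ω => by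
    simp only [Pi.sub_apply, mul_sub]
    rw [integral_sub (hb ω hf.1) (hb ω hg.1), hf.2, hg.2, sub_self]
  filter_upwards [this] with t ht
  exact sub_eq_zero.mp ht

variable {a c₁ v r : ℝ}

theorem continuous_min_exp (c₁ v r : ℝ) :
    Continuous fun t : ℝ => min 1 (Real.exp (c₁ * (v * |t| - r))) := by fun_prop

theorem integrable_exp_mul_min {μ : ℝ} (hμ : 0 < μ) (c₁ v r : ℝ) :
    Integrable fun t : ℝ =>
      Real.exp (-(μ * |t|)) * min 1 (Real.exp (c₁ * (v * |t| - r))) := by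
  refine (integrable_exp_neg_mul_abs hμ).mul_bdd (c := 1)
    (continuous_min_exp c₁ v r).aestronglyMeasurable ?_
  refine Filter.Eventually.of_forall fun t => ?_
  rw [Real.norm_eq_abs, abs_of_nonneg (le_min zero_le_one (Real.exp_nonneg _))]
  exact min_le_left _ _

theorem integral_exp_mul_min_le_of_le (ha : 0 < a) (hc₁ : 0 < c₁) (hv : 0 < v)
    (h : c₁ * v ≤ 2 * a) {m : ℝ} (hm : 1 ≤ m) :
    ∫ t : ℝ, Real.exp (-(m * a * |t|)) * min 1 (Real.exp (c₁ * (v * |t| - r))) ≤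
      8 / (m * a) * Real.exp (-(c₁ * r / (1 + c₁ * v / a))) := by
  have hma : 0 < m * a := by positivity
  have hden : 0 < 1 + c₁ * v / a := by positivity
  set E := Real.exp (-(c₁ * r / (1 + c₁ * v / a))) with hE
  have hx : c₁ * v / a ≤ 2 := by rw [div_le_iff₀ ha]; exact h
  have hpt : ∀ t : ℝ, Real.exp (-(m * a * |t|)) * min 1 (Real.exp (c₁ * (v * |t| - r))) ≤
      E * Real.exp (-(m * a / 3 * |t|)) := by
    intro t
    have hθ : min 1 (Real.exp (c₁ * (v * |t| - r))) ≤
        Real.exp (c₁ * (v * |t| - r) / (1 + c₁ * v / a)) := by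
      rcases le_total 0 (c₁ * (v * |t| - r)) with h0 | h0
      · exact (min_le_left _ _).trans (Real.one_le_exp (by positivity))
      · refine (min_le_right _ _).trans (Real.exp_le_exp.mpr ?_)
        rw [le_div_iff₀ hden]
        nlinarith [show 0 ≤ c₁ * v / a by positivity]
    refine (mul_le_mul_of_nonneg_left hθ (Real.exp_nonneg _)).trans ?_
    rw [hE, ← Real.exp_add, ← Real.exp_add]
    apply Real.exp_le_exp.mpr
    have e : c₁ * (v * |t| - r) / (1 + c₁ * v / a) =
        c₁ * v / (1 + c₁ * v / a) * |t| - c₁ * r / (1 + c₁ * v / a) := by ring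
    have hk : c₁ * v / (1 + c₁ * v / a) ≤ 2 / 3 * (m * a) := by
      have h1 : c₁ * v / (1 + c₁ * v / a) ≤ 2 / 3 * a := by
        rw [div_le_iff₀ hden]
        have : a * (c₁ * v / a) = c₁ * v := by field_simp
        nlinarith
      nlinarith
    have := mul_le_mul_of_nonneg_right hk (abs_nonneg t)
    rw [e]
    linarith
  calc _ ≤ ∫ t : ℝ, E * Real.exp (-(m * a / 3 * |t|)) :=
        integral_mono (integrable_exp_mul_min hma c₁ v r)
          ((integrable_exp_neg_mul_abs (by positivity)).const_mul _) hpt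
    _ = 6 / (m * a) * E := by
        rw [integral_const_mul, integral_exp_neg_mul_abs (by positivity)]
        field_simp
        ring
    _ ≤ 8 / (m * a) * E := by
        refine mul_le_mul_of_nonneg_right ?_ (Real.exp_nonneg _)
        gcongr
        norm_num

theorem integral_exp_mul_min_le_of_ge (ha : 0 < a) (hv : 0 < v)
    (h : 2 * a ≤ c₁ * v) (k : ℕ) :
    ∫ t : ℝ, Real.exp (-((2 * k + 1) * a * |t|)) * min 1 (Real.exp (c₁ * (v * |t| - r))) ≤
      8 / ((2 * k + 1) * a) * Real.exp (-(a * (r / v))) := by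
  set t₀ := r / v with ht₀
  set E := Real.exp (-(a * t₀)) with hE
  have hmin : ∀ t : ℝ, Real.exp (-(a * |t|)) * min 1 (Real.exp (c₁ * (v * |t| - r))) ≤
      E * Real.exp (-(a * |(|t| - t₀)|)) := by
    intro t
    rcases le_total t₀ |t| with h0 | h0
    · rw [abs_of_nonneg (sub_nonneg.mpr h0), hE, ← Real.exp_add]
      calc _ ≤ Real.exp (-(a * |t|)) * 1 :=
            mul_le_mul_of_nonneg_left (min_le_left _ _) (Real.exp_nonneg _)
        _ = _ := by rw [mul_one]; congr 1; ring
    · rw [abs_of_nonpos (sub_nonpos.mpr h0), hE, ← Real.exp_add]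
      refine (mul_le_mul_of_nonneg_left (min_le_right _ _) (Real.exp_nonneg _)).trans ?_
      rw [← Real.exp_add]
      apply Real.exp_le_exp.mpr
      have : c₁ * (v * |t| - r) = c₁ * v * (|t| - t₀) := by rw [ht₀]; field_simp
      rw [this]
      nlinarith [sub_nonpos.mpr h0]
  rcases Nat.eq_zero_or_pos k with rfl | hk
  · have hsh : ∀ s : ℝ, Integrable fun t : ℝ => Real.exp (-(a * |t - s|)) := fun s =>
      (integrable_exp_neg_mul_abs ha).comp_sub_right s
    have hpt : ∀ t : ℝ, Real.exp (-((2 * (0 : ℕ) + 1) * a * |t|)) *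
        min 1 (Real.exp (c₁ * (v * |t| - r))) ≤
        E * (Real.exp (-(a * |t - t₀|)) + Real.exp (-(a * |t - -t₀|))) := by
      intro t
      have e : (2 * ((0 : ℕ) : ℝ) + 1) * a * |t| = a * |t| := by push_cast; ring
      rw [e]
      refine (hmin t).trans (mul_le_mul_of_nonneg_left ?_ (Real.exp_nonneg _))
      rcases le_total 0 t with ht | ht
      · rw [abs_of_nonneg ht]
        exact le_add_of_nonneg_right (Real.exp_nonneg _)
      · rw [abs_of_nonpos ht, show |(-t - t₀)| = |t - -t₀| by rw [← abs_neg]; congr 1; ring]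
        exact le_add_of_nonneg_left (Real.exp_nonneg _)
    calc _ ≤ ∫ t : ℝ, E * (Real.exp (-(a * |t - t₀|)) + Real.exp (-(a * |t - -t₀|))) :=
          integral_mono (integrable_exp_mul_min (by push_cast; linarith) c₁ v r)
            (((hsh _).add (hsh _)).const_mul _) hpt
      _ = E * (2 / a + 2 / a) := by
          rw [integral_const_mul, integral_add (hsh _) (hsh _),
            integral_sub_right_eq_self (fun t => Real.exp (-(a * |t|))) t₀,
            integral_sub_right_eq_self (fun t => Real.exp (-(a * |t|))) (-t₀),
            integral_exp_neg_mul_abs ha]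
      _ = 4 / a * E := by ring
      _ ≤ 8 / ((2 * (0 : ℕ) + 1) * a) * E := by
          refine mul_le_mul_of_nonneg_right ?_ (Real.exp_nonneg _)
          rw [Nat.cast_zero, mul_zero, zero_add, one_mul]
          gcongr
          norm_num
  · have hk1 : (1 : ℝ) ≤ k := by exact_mod_cast hk
    have hpt : ∀ t : ℝ, Real.exp (-((2 * (k : ℝ) + 1) * a * |t|)) *
        min 1 (Real.exp (c₁ * (v * |t| - r))) ≤
        E * Real.exp (-((2 * (k : ℝ) + 1) * a / 2 * |t|)) := by
      intro t
      have e : Real.exp (-((2 * (k : ℝ) + 1) * a * |t|)) =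
          Real.exp (-(2 * k * a * |t|)) * Real.exp (-(a * |t|)) := by
        rw [← Real.exp_add]; congr 1; ring
      have h1 : Real.exp (-(a * |t|)) * min 1 (Real.exp (c₁ * (v * |t| - r))) ≤ E * 1 :=
        (hmin t).trans (mul_le_mul_of_nonneg_left
          (Real.exp_le_one_iff.mpr (by simp only [Left.neg_nonpos_iff]; positivity)) (Real.exp_nonneg _))
      have h2 : Real.exp (-(2 * k * a * |t|)) ≤ Real.exp (-((2 * (k : ℝ) + 1) * a / 2 * |t|)) := by
        apply Real.exp_le_exp.mpr
        have : 0 ≤ a * |t| := by positivity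
        nlinarith
      rw [e, mul_assoc, mul_comm E]
      rw [mul_one] at h1
      exact mul_le_mul h2 h1 (by positivity) (Real.exp_nonneg _)
    calc _ ≤ ∫ t : ℝ, E * Real.exp (-((2 * (k : ℝ) + 1) * a / 2 * |t|)) :=
          integral_mono (integrable_exp_mul_min (by positivity) c₁ v r)
            ((integrable_exp_neg_mul_abs (by positivity)).const_mul _) hpt
      _ = 4 / ((2 * k + 1) * a) * E := by
          rw [integral_const_mul, integral_exp_neg_mul_abs (by positivity)]
          field_simp
          norm_num
      _ ≤ 8 / ((2 * k + 1) * a) * E := by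
          refine mul_le_mul_of_nonneg_right ?_ (Real.exp_nonneg _)
          gcongr
          norm_num

theorem integral_exp_mul_min_le (ha : 0 < a) (hc₁ : 0 < c₁) (hv : 0 < v) (hr : 0 ≤ r) (k : ℕ) :
    ∫ t : ℝ, Real.exp (-((2 * k + 1) * a * |t|)) * min 1 (Real.exp (c₁ * (v * |t| - r))) ≤
      8 / ((2 * k + 1) * a) * Real.exp (-(c₁ * r / (1 + c₁ * v / a))) := by
  rcases le_total (c₁ * v) (2 * a) with h | h
  · exact integral_exp_mul_min_le_of_le ha hc₁ hv h (by linarith [Nat.cast_nonneg (α := ℝ) k])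
  · refine (integral_exp_mul_min_le_of_ge ha hv h k).trans ?_
    refine mul_le_mul_of_nonneg_left (Real.exp_le_exp.mpr (neg_le_neg ?_)) (by positivity)
    rw [div_le_iff₀ (by positivity)]
    have : a * (r / v) * (1 + c₁ * v / a) = a * (r / v) + c₁ * r := by field_simp
    rw [this]
    exact le_add_of_nonneg_left (by positivity)

theorem integral_thermalFilter_mul_min_le {β : ℝ} (hβ : 0 < β) (hc₁ : 0 < c₁) (hv : 0 < v)
    (hr : 0 ≤ r) :
    ∫ t : ℝ, thermalFilter β t * min 1 (Real.exp (c₁ * (v * |t| - r))) ≤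
      4 * Real.exp (-(c₁ * r / (1 + c₁ * v * β / Real.pi))) := by
  have hpi := Real.pi_pos
  set E := Real.exp (-(c₁ * r / (1 + c₁ * v * β / Real.pi))) with hE
  set b : ℝ → ℝ := fun t => min 1 (Real.exp (c₁ * (v * |t| - r))) with hb
  have hb0 : ∀ t, 0 ≤ b t := fun t => le_min zero_le_one (Real.exp_nonneg _)
  have hterm : ∀ k (t : ℝ), filterTerm β k t * b t = 4 / (β * Real.pi * (2 * k + 1)) *
      (Real.exp (-((2 * k + 1) * (Real.pi / β) * |t|)) * b t) := fun k t => by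
    rw [filterTerm, mul_assoc, mul_div_assoc]
  have hint : ∀ k, Integrable fun t => filterTerm β k t * b t := fun k => by
    simp only [hterm]
    exact (integrable_exp_mul_min (by positivity) c₁ v r).const_mul _
  have hle : ∀ k : ℕ, ∫ t, filterTerm β k t * b t ≤
      32 / Real.pi ^ 2 * E * (1 / (2 * (k : ℝ) + 1) ^ 2) := fun k => by
    simp only [hterm]
    rw [integral_const_mul]
    have := integral_exp_mul_min_le (r := r) (div_pos hpi hβ) hc₁ hv hr k
    have e : c₁ * v / (Real.pi / β) = c₁ * v * β / Real.pi := by field_simp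
    rw [e] at this
    refine (mul_le_mul_of_nonneg_left this (by positivity)).trans (le_of_eq ?_)
    rw [← hE]
    field_simp
    ring
  have hS := hasSum_one_div_odd_sq.mul_left (32 / Real.pi ^ 2 * E)
  have hsum : Summable fun k => ∫ t, ‖filterTerm β k t * b t‖ := by
    refine Summable.of_nonneg_of_le (fun k => integral_nonneg fun t => norm_nonneg _)
      (fun k => ?_) hS.summable
    refine le_trans (le_of_eq ?_) (hle k)
    refine integral_congr_ae (Filter.Eventually.of_forall fun t => ?_)
    exact Real.norm_of_nonneg (mul_nonneg (filterTerm_nonneg hβ k t) (hb0 t))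
  have hH := hasSum_integral_of_summable_integral_norm hint hsum
  have e : ∀ t : ℝ, ∑' k, filterTerm β k t * b t = thermalFilter β t * b t := fun t => by
    rw [tsum_mul_right, thermalFilter]
  simp only [e] at hH
  refine (hasSum_le hle hH hS).trans (le_of_eq ?_)
  field_simp
  ring

theorem integrable_thermalFilter_mul_min {β : ℝ} (hβ : 0 < β) (c₁ v r : ℝ) :
    Integrable fun t : ℝ => thermalFilter β t * min 1 (Real.exp (c₁ * (v * |t| - r))) := by
  refine (integrable_thermalFilter hβ).mul_bdd (c := 1)
    (continuous_min_exp c₁ v r).aestronglyMeasurable ?_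
  refine Filter.Eventually.of_forall fun t => ?_
  rw [Real.norm_eq_abs, abs_of_nonneg (le_min zero_le_one (Real.exp_nonneg _))]
  exact min_le_left _ _

end Filter

end SpinLattice

namespace SpinLattice

section Support

variable {D L d : ℕ} [NeZero L]

theorem tensorId_apply (A : Finset (Site D L)) (M : Matrix (A → Fin d) (A → Fin d) ℂ)
    (σ τ : Config D L d) [Decidable (∀ x, x ∉ A → σ x = τ x)] :
    tensorId A M σ τ = if ∀ x, x ∉ A → σ x = τ x then M (fun x => σ x) (fun x => τ x) else 0 := by
  simp only [tensorId, Matrix.of_apply, funext_iff, Subtype.forall]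
  split_ifs <;> rfl

theorem supportedOn_iff [NeZero d] {A : Finset (Site D L)} {O : Op D L d} :
    SupportedOn A O ↔
      (∀ σ τ : Config D L d, ∀ x, x ∉ A → σ x ≠ τ x → O σ τ = 0) ∧
      ∀ σ τ σ' τ' : Config D L d, (∀ x, x ∉ A → σ x = τ x) → (∀ x, x ∉ A → σ' x = τ' x) →
        (∀ x ∈ A, σ x = σ' x) → (∀ x ∈ A, τ x = τ' x) → O σ τ = O σ' τ' := by
  classical
  constructor
  · rintro ⟨M, rfl⟩
    refine ⟨fun σ τ x hx hne => ?_, fun σ τ σ' τ' h h' hσ hτ => ?_⟩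
    · rw [tensorId_apply, if_neg]
      exact fun h => hne (h x hx)
    · rw [tensorId_apply, tensorId_apply, if_pos h, if_pos h']
      congr 1
      · exact funext fun x => hσ x x.2
      · exact funext fun x => hτ x x.2
  · rintro ⟨h1, h2⟩
    refine ⟨Matrix.of fun a b => O (glue A a 0) (glue A b 0), ?_⟩
    ext σ τ
    rw [tensorId_apply]
    split_ifs with h
    · refine h2 _ _ _ _ h ?_ ?_ ?_
      · intro x hx; simp [glue, hx]
      · intro x hx; simp [glue, hx]
      · intro x hx; simp [glue, hx]
    · push Not at h
      obtain ⟨x, hx, hne⟩ := h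
      exact h1 σ τ x hx hne

theorem supportedOn_univ [NeZero d] (O : Op D L d) : SupportedOn Finset.univ O := by
  refine supportedOn_iff.mpr ⟨fun σ τ x hx => absurd (Finset.mem_univ x) hx, ?_⟩
  intro σ τ σ' τ' _ _ hσ hτ
  rw [funext fun x => hσ x (Finset.mem_univ x), funext fun x => hτ x (Finset.mem_univ x)]

theorem SupportedOn.inter [NeZero d] {A B : Finset (Site D L)}
    {O : Op D L d} (hA : SupportedOn A O) (hB : SupportedOn B O) : SupportedOn (A ∩ B) O := by
  obtain ⟨hA1, hA2⟩ := supportedOn_iff.mp hA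
  obtain ⟨hB1, hB2⟩ := supportedOn_iff.mp hB
  refine supportedOn_iff.mpr ⟨fun σ τ x hx hne => ?_, fun σ τ σ' τ' h h' hσ hτ => ?_⟩
  · by_cases hxA : x ∈ A
    · exact hB1 σ τ x (fun hxB => hx (Finset.mem_inter.mpr ⟨hxA, hxB⟩)) hne
    · exact hA1 σ τ x hxA hne
  · have hnA : ∀ x, x ∉ A → x ∉ A ∩ B := fun x hx h => hx (Finset.mem_inter.mp h).1
    have hnB : ∀ x, x ∉ B → x ∉ A ∩ B := fun x hx h => hx (Finset.mem_inter.mp h).2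
    refine (hA2 σ τ (fun x => if x ∈ A then σ x else σ' x) (fun x => if x ∈ A then τ x else τ' x)
      (fun x hx => h x (hnA x hx)) ?_ ?_ ?_).trans (hB2 _ _ σ' τ' ?_
      (fun x hx => h' x (hnB x hx)) ?_ ?_)
    · intro x hx; simp only [if_neg hx]; exact h' x (hnA x hx)
    · intro x hx; simp only [if_pos hx]
    · intro x hx; simp only [if_pos hx]
    · intro x hx
      by_cases hxA : x ∈ A
      · simp only [if_pos hxA]; exact h x (hnB x hx)
      · simp only [if_neg hxA]; exact h' x (hnB x hx)
    · intro x hx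
      by_cases hxA : x ∈ A
      · simp only [if_pos hxA]; exact hσ x (Finset.mem_inter.mpr ⟨hxA, hx⟩)
      · simp only [if_neg hxA]
    · intro x hx
      by_cases hxA : x ∈ A
      · simp only [if_pos hxA]; exact hτ x (Finset.mem_inter.mpr ⟨hxA, hx⟩)
      · simp only [if_neg hxA]

theorem supportedOn_opSupport [NeZero d] (O : Op D L d) : SupportedOn (opSupport O) O := by
  classical
  have h : opSupport O = (Finset.univ.filter fun A => SupportedOn A O).inf id := by
    ext x
    simp [opSupport, Finset.mem_inf]
  rw [h]
  refine Finset.inf_induction (p := fun A => SupportedOn A O) (supportedOn_univ O)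
    (fun A hA B hB => hA.inter hB) fun A hA => (Finset.mem_filter.mp hA).2

theorem SupportedOn.add [NeZero d] {A : Finset (Site D L)} {O P : Op D L d}
    (hO : SupportedOn A O) (hP : SupportedOn A P) : SupportedOn A (O + P) := by
  rw [supportedOn_iff] at *
  refine ⟨fun σ τ x hx hne => ?_, fun σ τ σ' τ' h h' hσ hτ => ?_⟩
  · rw [Matrix.add_apply, hO.1 σ τ x hx hne, hP.1 σ τ x hx hne, add_zero]
  · rw [Matrix.add_apply, Matrix.add_apply, hO.2 σ τ σ' τ' h h' hσ hτ, hP.2 σ τ σ' τ' h h' hσ hτ]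

theorem SupportedOn.smul [NeZero d] {A : Finset (Site D L)} {O : Op D L d}
    (hO : SupportedOn A O) (z : ℂ) : SupportedOn A (z • O) := by
  rw [supportedOn_iff] at *
  refine ⟨fun σ τ x hx hne => ?_, fun σ τ σ' τ' h h' hσ hτ => ?_⟩
  · rw [Matrix.smul_apply, hO.1 σ τ x hx hne, smul_zero]
  · rw [Matrix.smul_apply, Matrix.smul_apply, hO.2 σ τ σ' τ' h h' hσ hτ]

theorem SupportedOn.conjTranspose [NeZero d] {A : Finset (Site D L)} {O : Op D L d}
    (hO : SupportedOn A O) : SupportedOn A O.conjTranspose := by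
  rw [supportedOn_iff] at *
  refine ⟨fun σ τ x hx hne => ?_, fun σ τ σ' τ' h h' hσ hτ => ?_⟩
  · rw [Matrix.conjTranspose_apply, hO.1 τ σ x hx hne.symm, star_zero]
  · rw [Matrix.conjTranspose_apply, Matrix.conjTranspose_apply,
      hO.2 τ σ τ' σ' (fun x hx => (h x hx).symm) (fun x hx => (h' x hx).symm) hτ hσ]

end Support

section Localize

variable {D L d : ℕ} [NeZero L]

theorem localize_apply (A : Finset (Site D L)) (O : Op D L d) (σ τ : Config D L d)
    [Decidable (∀ x, x ∉ A → σ x = τ x)] :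
    localize A O σ τ = (Fintype.card ({x : Site D L // x ∉ A} → Fin d) : ℂ)⁻¹ *
      if ∀ x, x ∉ A → σ x = τ x then
        ∑ η : {x : Site D L // x ∉ A} → Fin d,
          O (glue A (fun x => σ x) η) (glue A (fun x => τ x) η)
      else 0 := by
  rw [localize, Matrix.smul_apply, tensorId_apply, smul_eq_mul]
  rfl

/-- The diagonal matrix of signs depending on the configuration outside `A`. -/
def signMatrix (A : Finset (Site D L)) (s : ({x : Site D L // x ∉ A} → Fin d) → ℤˣ) : Op D L d :=
  Matrix.diagonal fun σ => ((s fun x => σ x : ℤ) : ℂ)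

/-- Reflect a configuration outside `A` about `c`. -/
def reflect [NeZero d] (A : Finset (Site D L)) (c : {x : Site D L // x ∉ A} → Fin d)
    (σ : Config D L d) : Config D L d :=
  glue A (fun x => σ x) fun x => c x - σ x

/-- The permutation matrix of `reflect A c`. -/
def reflectMatrix [NeZero d] (A : Finset (Site D L)) (c : {x : Site D L // x ∉ A} → Fin d) :
    Op D L d :=
  Matrix.of fun σ τ => if reflect A c σ = τ then 1 else 0

theorem signMatrix_isHermitian (A : Finset (Site D L))
    (s : ({x : Site D L // x ∉ A} → Fin d) → ℤˣ) : (signMatrix A s).IsHermitian := by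
  rw [Matrix.IsHermitian, signMatrix, Matrix.diagonal_conjTranspose]
  congr 1
  funext σ
  simp

theorem signMatrix_mul_self (A : Finset (Site D L))
    (s : ({x : Site D L // x ∉ A} → Fin d) → ℤˣ) : signMatrix A s * signMatrix A s = 1 := by
  rw [signMatrix, Matrix.diagonal_mul_diagonal, ← Matrix.diagonal_one]
  congr 1
  funext σ
  rw [← Int.cast_mul, ← Units.val_mul, Int.units_mul_self]
  simp

theorem supportedOn_signMatrix [NeZero d] (A : Finset (Site D L))
    (s : ({x : Site D L // x ∉ A} → Fin d) → ℤˣ) : SupportedOn Aᶜ (signMatrix A s) := by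
  refine supportedOn_iff.mpr ⟨fun σ τ x _ hne => ?_, fun σ τ σ' τ' h h' hσ hτ => ?_⟩
  · exact Matrix.diagonal_apply_ne _ fun h => hne (congrFun h x)
  · have hiff : σ = τ ↔ σ' = τ' := by
      constructor <;> intro he <;> funext x
      · by_cases hx : x ∈ Aᶜ
        · rw [← hσ x hx, ← hτ x hx, he]
        · exact h' x hx
      · by_cases hx : x ∈ Aᶜ
        · rw [hσ x hx, hτ x hx, he]
        · exact h x hx
    have hr : (fun x : {x : Site D L // x ∉ A} => σ x) = fun x : {x : Site D L // x ∉ A} => σ' x :=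
      funext fun x => hσ x (Finset.mem_compl.mpr x.2)
    simp only [signMatrix, Matrix.diagonal_apply, hiff, hr]

omit [NeZero L] in
theorem reflect_reflect [NeZero d] (A : Finset (Site D L)) (c : {x : Site D L // x ∉ A} → Fin d)
    (σ : Config D L d) : reflect A c (reflect A c σ) = σ := by
  funext x
  by_cases hx : x ∈ A <;> simp [reflect, glue, hx]

omit [NeZero L] in
theorem reflect_eq_comm [NeZero d] {A : Finset (Site D L)} {c : {x : Site D L // x ∉ A} → Fin d}
    {σ τ : Config D L d} : reflect A c σ = τ ↔ reflect A c τ = σ := by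
  constructor <;> rintro rfl <;> exact reflect_reflect A c _

theorem reflectMatrix_isHermitian [NeZero d] (A : Finset (Site D L))
    (c : {x : Site D L // x ∉ A} → Fin d) : (reflectMatrix A c).IsHermitian := by
  ext σ τ
  rw [Matrix.conjTranspose_apply, reflectMatrix, Matrix.of_apply, Matrix.of_apply]
  simp only [reflect_eq_comm (σ := τ)]
  split_ifs <;> simp

theorem reflectMatrix_mul [NeZero d] (A : Finset (Site D L))
    (c : {x : Site D L // x ∉ A} → Fin d) (X : Op D L d) (σ τ : Config D L d) :
    (reflectMatrix A c * X) σ τ = X (reflect A c σ) τ := by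
  simp [Matrix.mul_apply, reflectMatrix]

theorem mul_reflectMatrix [NeZero d] (A : Finset (Site D L))
    (c : {x : Site D L // x ∉ A} → Fin d) (X : Op D L d) (σ τ : Config D L d) :
    (X * reflectMatrix A c) σ τ = X σ (reflect A c τ) := by
  simp [Matrix.mul_apply, reflectMatrix, reflect_eq_comm (τ := τ)]

theorem reflectMatrix_mul_self [NeZero d] (A : Finset (Site D L))
    (c : {x : Site D L // x ∉ A} → Fin d) : reflectMatrix A c * reflectMatrix A c = 1 := by
  ext σ τ
  rw [reflectMatrix_mul, reflectMatrix, Matrix.of_apply, reflect_reflect, Matrix.one_apply]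

theorem supportedOn_reflectMatrix [NeZero d] (A : Finset (Site D L))
    (c : {x : Site D L // x ∉ A} → Fin d) : SupportedOn Aᶜ (reflectMatrix A c) := by
  refine supportedOn_iff.mpr ⟨fun σ τ x hx hne => ?_, fun σ τ σ' τ' h h' hσ hτ => ?_⟩
  · rw [reflectMatrix, Matrix.of_apply, if_neg]
    rintro rfl
    have hxA : x ∈ A := by simpa using hx
    simp [reflect, glue, hxA] at hne
  · have key : ∀ σ τ σ' τ' : Config D L d, (∀ x, x ∉ Aᶜ → σ' x = τ' x) →
        (∀ x ∈ Aᶜ, σ x = σ' x) → (∀ x ∈ Aᶜ, τ x = τ' x) → reflect A c σ = τ →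
        reflect A c σ' = τ' := by
      intro σ τ σ' τ' h' hσ hτ he
      funext x
      by_cases hx : x ∈ A
      · have := h' x (by simpa using hx)
        simpa [reflect, glue, hx] using this
      · have hx' : x ∈ Aᶜ := by simpa using hx
        rw [← hτ x hx', ← he]
        simp [reflect, glue, hx, hσ x hx']
    have hiff : reflect A c σ = τ ↔ reflect A c σ' = τ' :=
      ⟨key σ τ σ' τ' h' hσ hτ, key σ' τ' σ τ h (fun x hx => (hσ x hx).symm)
        (fun x hx => (hτ x hx).symm)⟩
    simp only [reflectMatrix, Matrix.of_apply, hiff]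

/-- The average of a finite family of operators. -/
noncomputable def average {ι : Type*} [Fintype ι] (U : ι → Op D L d) : Op D L d :=
  (Fintype.card ι : ℂ)⁻¹ • ∑ i, U i

theorem norm_sub_average_le {ι : Type*} [Fintype ι] [Nonempty ι] {U : ι → Op D L d}
    {X : Op D L d} {K : ℝ} (h : ∀ i, ‖X - U i‖ ≤ K) : ‖X - average U‖ ≤ K := by
  have hc : (Fintype.card ι : ℂ) ≠ 0 := Nat.cast_ne_zero.mpr Fintype.card_ne_zero
  have hc' : (0 : ℝ) < Fintype.card ι := Nat.cast_pos.mpr Fintype.card_pos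
  have e : X - average U = (Fintype.card ι : ℂ)⁻¹ • ∑ i, (X - U i) := by
    rw [average, Finset.sum_sub_distrib, smul_sub, Finset.sum_const, Finset.card_univ,
      ← Nat.cast_smul_eq_nsmul ℂ, smul_smul, inv_mul_cancel₀ hc, one_smul]
  rw [e, norm_smul, norm_inv, Complex.norm_natCast, inv_mul_le_iff₀ hc']
  refine (norm_sum_le _ _).trans ((Finset.sum_le_sum fun i _ => h i).trans ?_)
  rw [Finset.sum_const, Finset.card_univ, nsmul_eq_mul]

theorem sum_units_mul {E : Type*} [Fintype E] [DecidableEq E] (a b : E) :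
    ∑ s : E → ℤˣ, (((s a : ℤ) : ℂ) * ((s b : ℤ) : ℂ)) =
      if a = b then (Fintype.card (E → ℤˣ) : ℂ) else 0 := by
  split_ifs with h
  · subst h
    have : ∀ s : E → ℤˣ, (((s a : ℤ) : ℂ) * ((s a : ℤ) : ℂ)) = 1 := fun s => by
      rw [← Int.cast_mul, ← Units.val_mul, Int.units_mul_self]; simp
    simp only [this, Finset.sum_const, Finset.card_univ, nsmul_eq_mul, mul_one]
  · have h1 := Equiv.sum_comp (Equiv.mulRight (Pi.mulSingle a (-1) : E → ℤˣ))
      fun s : E → ℤˣ => (((s a : ℤ) : ℂ) * ((s b : ℤ) : ℂ))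
    have h2 : ∀ s : E → ℤˣ, ((((Equiv.mulRight (Pi.mulSingle a (-1) : E → ℤˣ)) s a : ℤˣ) : ℤ) : ℂ) *
        ((((Equiv.mulRight (Pi.mulSingle a (-1) : E → ℤˣ)) s b : ℤˣ) : ℤ) : ℂ) =
        -(((s a : ℤ) : ℂ) * ((s b : ℤ) : ℂ)) := fun s => by
      simp [Pi.mulSingle_eq_of_ne' h]
    simp only [h2, Finset.sum_neg_distrib] at h1
    exact self_eq_neg.mp h1.symm

theorem average_signMatrix_apply (A : Finset (Site D L)) (X : Op D L d) (σ τ : Config D L d)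
    [Decidable (∀ x, x ∉ A → σ x = τ x)] :
    average (fun s : ({x : Site D L // x ∉ A} → Fin d) → ℤˣ =>
      signMatrix A s * X * signMatrix A s) σ τ =
      if ∀ x, x ∉ A → σ x = τ x then X σ τ else 0 := by
  classical
  have hc : (Fintype.card (({x : Site D L // x ∉ A} → Fin d) → ℤˣ) : ℂ) ≠ 0 :=
    Nat.cast_ne_zero.mpr Fintype.card_ne_zero
  have e : ∀ s : ({x : Site D L // x ∉ A} → Fin d) → ℤˣ, (signMatrix A s * X * signMatrix A s) σ τ =
      X σ τ * ((((s fun x => σ x : ℤˣ) : ℤ) : ℂ) * (((s fun x => τ x : ℤˣ) : ℤ) : ℂ)) := fun s => by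
    rw [signMatrix, Matrix.mul_diagonal, Matrix.diagonal_mul]; ring
  rw [average, Matrix.smul_apply, Matrix.sum_apply]
  simp only [e]
  rw [← Finset.mul_sum, sum_units_mul, smul_eq_mul]
  simp only [funext_iff, Subtype.forall]
  split_ifs
  · field_simp
  · simp

theorem localize_eq_average [NeZero d] (A : Finset (Site D L)) (X : Op D L d) :
    localize A X = average fun c => reflectMatrix A c *
      average (fun s => signMatrix A s * X * signMatrix A s) * reflectMatrix A c := by
  classical
  ext σ τ
  rw [localize_apply, average, Matrix.smul_apply, Matrix.sum_apply, smul_eq_mul]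
  congr 1
  have hiff : ∀ c : {x : Site D L // x ∉ A} → Fin d,
      (∀ x, x ∉ A → reflect A c σ x = reflect A c τ x) ↔ ∀ x, x ∉ A → σ x = τ x := fun c => by
    refine forall₂_congr fun x hx => ?_
    simp [reflect, glue, hx]
  simp only [mul_reflectMatrix, reflectMatrix_mul, average_signMatrix_apply, hiff]
  split_ifs with h
  · refine (Equiv.sum_comp (Equiv.subRight fun x : {x : Site D L // x ∉ A} => σ x) _).symm.trans ?_
    refine Finset.sum_congr rfl fun c _ => ?_
    have : (fun x : {x : Site D L // x ∉ A} => c x - σ x) = fun x : {x : Site D L // x ∉ A} => c x - τ x :=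
      funext fun x => by rw [h x x.2]
    simp only [reflect, ← this]
    rfl
  · simp

theorem mem_unitary_of_isHermitian {Q : Op D L d} (h : Q.IsHermitian) (hQ : Q * Q = 1) :
    Q ∈ unitary (Op D L d) := by
  have : star Q = Q := h
  rw [Unitary.mem_iff, this]
  exact ⟨hQ, hQ⟩

theorem norm_sub_conj_le {Q X : Op D L d} (h : Q.IsHermitian) (hQ : Q * Q = 1) :
    ‖X - Q * X * Q‖ = ‖X * Q - Q * X‖ := by
  have e : X - Q * X * Q = (X * Q - Q * X) * Q := by
    rw [sub_mul, mul_assoc X, hQ, mul_one]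
  rw [e, CStarRing.norm_mul_mem_unitary _ (mem_unitary_of_isHermitian h hQ)]

theorem norm_sub_localize_le [NeZero d] {A : Finset (Site D L)}
    {X : Op D L d} {K : ℝ}
    (h : ∀ Q : Op D L d, Q.IsHermitian → Q * Q = 1 → SupportedOn Aᶜ Q → ‖X * Q - Q * X‖ ≤ K) :
    ‖X - localize A X‖ ≤ 2 * K := by
  have hXY : ‖X - average fun s : ({x : Site D L // x ∉ A} → Fin d) → ℤˣ =>
      signMatrix A s * X * signMatrix A s‖ ≤ K := norm_sub_average_le fun s => by
    rw [norm_sub_conj_le (signMatrix_isHermitian A s) (signMatrix_mul_self A s)]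
    exact h _ (signMatrix_isHermitian A s) (signMatrix_mul_self A s) (supportedOn_signMatrix A s)
  rw [localize_eq_average]
  revert hXY
  generalize (average fun s : ({x : Site D L // x ∉ A} → Fin d) → ℤˣ =>
      signMatrix A s * X * signMatrix A s) = Y
  intro hXY
  refine norm_sub_average_le fun c => ?_
  have hh := reflectMatrix_isHermitian A c
  have hm := reflectMatrix_mul_self A c
  have hu := mem_unitary_of_isHermitian hh hm
  have e : X - reflectMatrix A c * Y * reflectMatrix A c =
      (X - reflectMatrix A c * X * reflectMatrix A c) +
        reflectMatrix A c * (X - Y) * reflectMatrix A c := by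
    rw [mul_sub, sub_mul, sub_add_sub_cancel]
  rw [e, two_mul]
  refine (norm_add_le _ _).trans (add_le_add ?_ ?_)
  · rw [norm_sub_conj_le hh hm]
    exact h _ hh hm (supportedOn_reflectMatrix A c)
  · rwa [CStarRing.norm_mul_mem_unitary _ hu, CStarRing.norm_mem_unitary_mul _ hu]

end Localize

end SpinLattice

namespace SpinLattice

section Geometry

variable {D L : ℕ} [NeZero L]

theorem card_siteBall_le (x : Site D L) (r : ℝ) :
    (siteBall x r).card ≤ (2 * ⌊r⌋₊ + 1) ^ D := by
  classical
  have hcard : (Fintype.piFinset fun _ : Fin D => Finset.Icc (-(⌊r⌋₊ : ℤ)) ⌊r⌋₊).card =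
      (2 * ⌊r⌋₊ + 1) ^ D := by
    rw [Fintype.card_piFinset, Finset.prod_const, Int.card_Icc, Finset.card_univ, Fintype.card_fin]
    congr 1
    omega
  rw [← hcard]
  refine Finset.card_le_card_of_injOn (fun y k => (x k - y k).valMinAbs) ?_ ?_
  · intro y hy
    have hy' : (siteDist x y : ℝ) ≤ r := by simpa [siteBall] using hy
    have hn : siteDist x y ≤ ⌊r⌋₊ := Nat.le_floor hy'
    refine Finset.mem_coe.mpr (Fintype.mem_piFinset.mpr fun k => ?_)
    have : (x k - y k).valMinAbs.natAbs ≤ siteDist x y :=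
      Finset.single_le_sum (f := fun k => (x k - y k).valMinAbs.natAbs)
        (fun _ _ => Nat.zero_le _) (Finset.mem_univ k)
    rw [Finset.mem_Icc]
    dsimp only
    omega
  · intro y _ z _ h
    funext k
    exact sub_right_injective (ZMod.valMinAbs_inj.mp (congrFun h k))

theorem le_regionDist_compl_nbhd {A : Finset (Site D L)} {r : ℝ} (hA : A.Nonempty)
    (hB : (nbhd A r)ᶜ.Nonempty) : r ≤ regionDist A (nbhd A r)ᶜ := by
  obtain ⟨x, hx⟩ := hA
  obtain ⟨y, hy⟩ := hB
  obtain ⟨x', hx', y', hy', h⟩ := Nat.sInf_mem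
    (s := {n : ℕ | ∃ x ∈ A, ∃ y ∈ (nbhd A r)ᶜ, n = siteDist x y}) ⟨_, x, hx, y, hy, rfl⟩
  rw [regionDist, h]
  by_contra hlt
  exact Finset.mem_compl.mp hy' (by simpa [nbhd] using ⟨x', hx', (not_le.mp hlt).le⟩)

end Geometry

section Dynamics

variable {D L d : ℕ} [NeZero L] {H V : Op D L d} {c c₁ v : ℝ}

theorem exp_mem_unitary (hH : H.IsHermitian) (t : ℝ) :
    NormedSpace.exp ((Complex.I * t) • H) ∈ unitary (Op D L d) := by
  let +nondep : NormedAlgebra ℚ (Op D L d) := .restrictScalars ℚ ℂ (Op D L d)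
  refine NormedSpace.exp_mem_unitary_of_mem_skewAdjoint (skewAdjoint.mem_iff.mpr ?_)
  have : star H = H := hH
  rw [star_smul, this]
  simp

theorem norm_evolve (hH : H.IsHermitian) (t : ℝ) (O : Op D L d) : ‖evolve H t O‖ = ‖O‖ := by
  have h1 := exp_mem_unitary hH t
  have h2 := exp_mem_unitary hH (-t)
  rw [Complex.ofReal_neg, mul_neg] at h2
  rw [evolve, CStarRing.norm_mul_mem_unitary _ h1, CStarRing.norm_mem_unitary_mul _ h2]

theorem continuous_evolve (H O : Op D L d) : Continuous fun t : ℝ => evolve H t O := by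
  let +nondep : NormedAlgebra ℚ (Op D L d) := .restrictScalars ℚ ℂ (Op D L d)
  have hexp : Continuous (NormedSpace.exp : Op D L d → Op D L d) := NormedSpace.exp_continuous
  have h1 : Continuous fun t : ℝ => (-(Complex.I * (t : ℂ))) • H :=
    (by fun_prop : Continuous fun t : ℝ => -(Complex.I * (t : ℂ))).smul continuous_const
  have h2 : Continuous fun t : ℝ => (Complex.I * (t : ℂ)) • H :=
    (by fun_prop : Continuous fun t : ℝ => Complex.I * (t : ℂ)).smul continuous_const
  exact ((hexp.comp h1).mul continuous_const).mul (hexp.comp h2)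

theorem evolve_add (H O P : Op D L d) (t : ℝ) :
    evolve H t (O + P) = evolve H t O + evolve H t P := by
  rw [evolve, mul_add, add_mul]; rfl

theorem evolve_smul (H O : Op D L d) (t : ℝ) (z : ℂ) :
    evolve H t (z • O) = z • evolve H t O := by
  rw [evolve, mul_smul_comm, smul_mul_assoc]; rfl

/-- The map `O ↦ O - [O]_A` as a continuous linear map. -/
noncomputable def subLocalize (A : Finset (Site D L)) : Op D L d →L[ℂ] Op D L d :=
  LinearMap.toContinuousLinearMap
    { toFun := fun O => O - localize A O
      map_add' := fun O P => by
        classical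
        ext σ τ
        simp only [Matrix.sub_apply, Matrix.add_apply, localize_apply]
        split_ifs
        · rw [Finset.sum_add_distrib]; ring
        · ring
      map_smul' := fun z O => by
        classical
        ext σ τ
        simp only [Matrix.sub_apply, Matrix.smul_apply, localize_apply, smul_eq_mul,
          RingHom.id_apply]
        split_ifs
        · rw [← Finset.mul_sum]; ring
        · ring }

theorem subLocalize_apply (A : Finset (Site D L)) (O : Op D L d) :
    subLocalize A O = O - localize A O := rfl

theorem integrable_smul_evolve (hH : H.IsHermitian) {f : ℝ → ℂ} (hf : Integrable f)
    (O : Op D L d) : Integrable fun t => f t • evolve H t O := by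
  refine (hf.norm.mul_const ‖O‖).mono'
    (hf.aestronglyMeasurable.smul (continuous_evolve H O).aestronglyMeasurable) ?_
  exact Filter.Eventually.of_forall fun t => by rw [norm_smul, norm_evolve hH]

theorem LiebRobinson.norm_commutator_le [NeZero d] (hLR : LiebRobinson H c c₁ v)
    (hH : H.IsHermitian) (hc : 0 < c) (hc₁ : 0 < c₁) {S B : Finset (Site D L)} {N : ℕ}
    (hN : S.card ≤ N) {P Q : Op D L d} (hP : P.IsHermitian) (hPS : SupportedOn S P)
    (hQ : Q.IsHermitian) (hQQ : Q * Q = 1) (hQS : SupportedOn B Q) {r : ℝ}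
    (hr : S.Nonempty → B.Nonempty → r ≤ regionDist S B) (t : ℝ) :
    ‖evolve H t P * Q - Q * evolve H t P‖ ≤
      (c * N + 2) * ‖P‖ * min 1 (Real.exp (c₁ * (v * |t| - r))) := by
  have hu := mem_unitary_of_isHermitian hQ hQQ
  have hQ1 : ‖Q‖ = 1 := CStarRing.norm_of_mem_unitary hu
  have hcN : 0 ≤ c * N := by positivity
  set E := Real.exp (c₁ * (v * |t| - r)) with hE
  have hE0 : 0 < E := Real.exp_pos _
  have htriv : ‖evolve H t P * Q - Q * evolve H t P‖ ≤ 2 * ‖P‖ := by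
    refine (norm_sub_le _ _).trans ?_
    rw [CStarRing.norm_mul_mem_unitary _ hu, CStarRing.norm_mem_unitary_mul _ hu, norm_evolve hH,
      two_mul]
  have hlr : ‖evolve H t P * Q - Q * evolve H t P‖ ≤ c * N * ‖P‖ * E := by
    have h := hLR S B P Q hP hQ hPS hQS t
    rw [hQ1, mul_one] at h
    refine h.trans ?_
    have hrhs : 0 ≤ c * N * ‖P‖ * E := mul_nonneg (mul_nonneg hcN (norm_nonneg P)) hE0.le
    by_cases hz : min S.card B.card = 0
    · rw [hz, Nat.cast_zero, mul_zero, zero_mul]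
      exact hrhs
    have hd := hr (Finset.card_ne_zero.mp fun h => hz (by rw [h, Nat.zero_min]))
      (Finset.card_ne_zero.mp fun h => hz (by rw [h, Nat.min_zero]))
    have hmin : ((min S.card B.card : ℕ) : ℝ) ≤ N := by
      exact_mod_cast (min_le_left _ _).trans hN
    have hexp : Real.exp (c₁ * (v * |t| - regionDist S B)) ≤ E :=
      Real.exp_le_exp.mpr (mul_le_mul_of_nonneg_left (by linarith) hc₁.le)
    have hcP : 0 ≤ c * ‖P‖ := mul_nonneg hc.le (norm_nonneg P)
    exact (mul_le_mul (mul_le_mul_of_nonneg_left hmin hcP) hexp (Real.exp_nonneg _)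
      (mul_nonneg hcP N.cast_nonneg)).trans (le_of_eq (by ring))
  rcases le_total 1 E with h | h
  · rw [min_eq_left h, mul_one]
    exact htriv.trans (mul_le_mul_of_nonneg_right (by linarith) (norm_nonneg _))
  · rw [min_eq_right h]
    exact hlr.trans (mul_le_mul_of_nonneg_right
      (mul_le_mul_of_nonneg_right (by linarith) (norm_nonneg P)) hE0.le)

theorem LiebRobinson.norm_evolve_sub_localize_le [NeZero d] (hLR : LiebRobinson H c c₁ v)
    (hH : H.IsHermitian) (hc : 0 < c) (hc₁ : 0 < c₁) {S : Finset (Site D L)} {N : ℕ}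
    (hN : S.card ≤ N) (hV : SupportedOn S V) (r t : ℝ) :
    ‖evolve H t V - localize (nbhd S r) (evolve H t V)‖ ≤
      4 * (c * N + 2) * ‖V‖ * min 1 (Real.exp (c₁ * (v * |t| - r))) := by
  set b := min 1 (Real.exp (c₁ * (v * |t| - r))) with hb
  have hb0 : 0 ≤ b := le_min zero_le_one (Real.exp_nonneg _)
  have hcN : 0 ≤ c * N + 2 := by positivity
  have hherm : ∀ P : Op D L d, P.IsHermitian → SupportedOn S P → ‖P‖ ≤ ‖V‖ →
      ‖subLocalize (nbhd S r) (evolve H t P)‖ ≤ 2 * ((c * N + 2) * ‖V‖ * b) := by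
    intro P hP hPS hPV
    rw [subLocalize_apply]
    refine norm_sub_localize_le fun Q hQ hQQ hQS => ?_
    refine (hLR.norm_commutator_le hH hc hc₁ hN hP hPS hQ hQQ hQS
      le_regionDist_compl_nbhd t).trans ?_
    exact mul_le_mul_of_nonneg_right (mul_le_mul_of_nonneg_left hPV hcN) hb0
  have hadj : ‖V.conjTranspose‖ = ‖V‖ := Matrix.l2_opNorm_conjTranspose V
  set P : Op D L d := (1 / 2 : ℂ) • (V + V.conjTranspose) with hPdef
  set Q : Op D L d := (-(Complex.I / 2)) • (V + (-1 : ℂ) • V.conjTranspose) with hQdef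
  have hdec : V = P + Complex.I • Q := by
    have : Complex.I * -(Complex.I / 2) = 1 / 2 := by linear_combination (-1 / 2) * Complex.I_sq
    rw [hPdef, hQdef, smul_smul, this]
    module
  have hP : P.IsHermitian := by
    rw [Matrix.IsHermitian, hPdef, Matrix.conjTranspose_smul, Matrix.conjTranspose_add,
      Matrix.conjTranspose_conjTranspose, add_comm]
    simp
  have hQ : Q.IsHermitian := by
    rw [Matrix.IsHermitian, hQdef, Matrix.conjTranspose_smul, Matrix.conjTranspose_add,
      Matrix.conjTranspose_smul, Matrix.conjTranspose_conjTranspose]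
    simp only [star_neg, star_div₀, star_one, Complex.star_def, Complex.conj_I, Complex.conj_ofNat]
    module
  have hPn : ‖P‖ ≤ ‖V‖ := by
    rw [hPdef, norm_smul]
    have := norm_add_le V V.conjTranspose
    rw [hadj] at this
    norm_num
    linarith
  have hQn : ‖Q‖ ≤ ‖V‖ := by
    rw [hQdef, norm_smul]
    have := norm_add_le V ((-1 : ℂ) • V.conjTranspose)
    rw [norm_smul, hadj] at this
    simp only [norm_neg, norm_one, one_mul, norm_div, Complex.norm_I, Complex.norm_ofNat] at this ⊢
    linarith
  have hPS : SupportedOn S P := (hV.add hV.conjTranspose).smul _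
  have hQS : SupportedOn S Q := (hV.add (hV.conjTranspose.smul _)).smul _
  have h1 := hherm P hP hPS hPn
  have h2 := hherm Q hQ hQS hQn
  have e : evolve H t V = evolve H t P + Complex.I • evolve H t Q := by
    rw [← evolve_smul, ← evolve_add, ← hdec]
  rw [← subLocalize_apply, e, map_add, map_smul]
  refine (norm_add_le _ _).trans ?_
  rw [norm_smul, Complex.norm_I, one_mul]
  linarith

theorem LiebRobinson.norm_phi_sub_localize_le [NeZero d] (hLR : LiebRobinson H c c₁ v)
    (hH : H.IsHermitian) (hc : 0 < c) (hc₁ : 0 < c₁) (hv : 0 < v) {S : Finset (Site D L)} {N : ℕ}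
    (hN : S.card ≤ N) (hV : SupportedOn S V) {β : ℝ} (hβ : 0 < β) {f : ℝ → ℂ}
    (hf : IsThermalFilter β f) {r : ℝ} (hr : 0 ≤ r) :
    ‖Phi H f V - localize (nbhd S r) (Phi H f V)‖ ≤
      16 * (c * N + 2) * ‖V‖ * Real.exp (-(c₁ * r / (1 + c₁ * v * β / Real.pi))) := by
  have hcN : 0 ≤ c * N + 2 := by positivity
  rw [← subLocalize_apply, Phi,
    ← ContinuousLinearMap.integral_comp_comm _ (integrable_smul_evolve hH hf.1 V)]
  refine (norm_integral_le_of_norm_le ((integrable_thermalFilter_mul_min hβ c₁ v r).const_mul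
    (4 * (c * N + 2) * ‖V‖)) ?_).trans ?_
  · filter_upwards [hf.ae_eq (isThermalFilter_thermalFilter hβ)] with t ht
    rw [map_smul, norm_smul, ht, Complex.norm_real, Real.norm_of_nonneg (thermalFilter_nonneg hβ t),
      subLocalize_apply, mul_left_comm]
    exact mul_le_mul_of_nonneg_left
      (hLR.norm_evolve_sub_localize_le hH hc hc₁ hN hV r t) (thermalFilter_nonneg hβ t)
  · rw [integral_const_mul]
    refine (mul_le_mul_of_nonneg_left (integral_thermalFilter_mul_min_le hβ hc₁ hv hr)
      (by positivity)).trans (le_of_eq (by ring))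

end Dynamics

end SpinLattice

theorem mainTheorem9 (D : ℕ) (r₀ c c₁ : ℝ) (hc : 0 < c) (hc₁ : 0 < c₁) :
    (∀ β : ℝ, 0 < β → ∃ f : ℝ → ℂ, SpinLattice.IsThermalFilter β f) ∧
    ∃ C c' : ℝ, 0 < C ∧ 0 < c' ∧
      ∀ (L d : ℕ) [NeZero L], 1 ≤ d →
      ∀ (H : SpinLattice.Op D L d), H.IsHermitian →
      ∀ v : ℝ, 0 < v → SpinLattice.LiebRobinson H c c₁ v →
      ∀ β : ℝ, 0 < β →
      ∀ f : ℝ → ℂ, SpinLattice.IsThermalFilter β f →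
      ∀ (V : SpinLattice.Op D L d) (x : SpinLattice.Site D L),
        SpinLattice.opSupport V ⊆ SpinLattice.siteBall x r₀ →
      ∀ r : ℝ, 0 ≤ r →
        ‖SpinLattice.Phi H f V -
            SpinLattice.localize (SpinLattice.nbhd (SpinLattice.opSupport V) r)
              (SpinLattice.Phi H f V)‖ ≤
          C * ‖V‖ * Real.exp (-(c' * r / (1 + c' * v * β / Real.pi))) := by
  refine ⟨fun β hβ => ⟨_, SpinLattice.isThermalFilter_thermalFilter hβ⟩,
    16 * (c * ((2 * ⌊r₀⌋₊ + 1) ^ D : ℕ) + 2), c₁, by positivity, hc₁, ?_⟩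
  intro L d _ hd H hH v hv hLR β hβ f hf V x hV r hr
  have : NeZero d := ⟨by omega⟩
  exact hLR.norm_phi_sub_localize_le hH hc hc₁ hv
    ((Finset.card_le_card hV).trans (SpinLattice.card_siteBall_le x r₀))
    (SpinLattice.supportedOn_opSupport V) hβ hf hr
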